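/- Let $R$ be a commutative unital ring, $A,B$ unital $R$-algebras, $M$ an $(A,B)$-bimodule and $N$ a $(B,A)$-bimodule (over $R$), both $2$-torsion free ($2x=0$ implies $x=0$), and let $\Phi:M\otimes_B N\to A$, $\Psi:N\otimes_A M\to B$ be bimodule homomorphisms, written $mn=\Phi(m\otimes n)$ and $nm=\Psi(n\otimes m)$, with $(mn)m'=m(nm')$ and $(nm)n'=n(mn')$ for all $m,m'\in M$, $n,n'\in N$. Let $\mathcal G=\begin{pmatrix}A&M\\N&B\end{pmatrix}$ be the generalized matrix algebra, with the usual matrix operations, $\pi_A,\pi_B$ its projections to $A$ and $B$, $a\oplus b$ the diagonal matrix with entries $a\in A$, $b\in B$, and $Z(\cdot)$ the center. $\mathcal G$ is called trivial if $mn=0$ and $nm=0$ for all $m\in M$, $n\in N$, and weakly faithful if, for $a\in A$, $aM=0=Na$ implies $a=0$ and, for $b\in B$, $Mb=0=bN$ implies $b=0$. A sequence $\{\mathcal D_k\}_{k\ge 0}$ of $R$-linear maps on an $R$-algebra $S$ with $\mathcal D_0=\mathrm{id}$ is a higher derivation if $\mathcal D_k(xy)=\sum_{i+j=k}\mathcal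 D_i(x)\mathcal D_j(y)$ for all $x,y\in S$ and $k\ge 0$; a sequence $\{\mathcal L_k\}_{k\ge0}$ of $R$-linear maps with $\mathcal L_0=\mathrm{id}$ is a Lie higher derivation if $\mathcal L_k([x,y])=\sum_{i+j=k}[\mathcal L_i(x),\mathcal L_j(y)]$ for all $x,y\in S$ and $k\ge 0$. It is proper if there are a higher derivation $\{\mathcal D_k\}_{k\ge 0}$ and $R$-linear maps $\tau_k:S\to Z(S)$ ($k\ge1$) vanishing on all commutators with $\mathcal L_k=\mathcal D_k+\tau_k$ for all $k\ge1$. $S$ has the LHD property if every Lie higher derivation on it is proper. For a sequence $\mathcal L=\{\mathcal L_k\}_{k\ge0}$ of $R$-linear maps on $\mathcal G$ and $k\ge 1$ put $\mathfrak p_{1k}(a)=\pi_A\mathcal L_k(a\oplus 0)$, $\mathfrak q_{1k}(a)=\pi_B\mathcal L_k(a\oplus 0)$, $\mathfrak p_{2k}(b)=\pi_A\mathcal L_k(0\oplus b)$, $\mathfrak q_{2k}(b)=\pi_B\mathcal L_k(0\oplus b)$, and let $m_k\in M$, $n_k\in N$ be the off-diagonal entries of $\mathcal L_k(1\oplus 0)$.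 Define recursively $P_0=\mathrm{id}_A$, $Q''_0=0$, $Q_0=\mathrm{id}_B$, $P''_0=0$, and for $k\ge1$ \[P_k(a)=\mathfrak p_{1k}(a)+\sum\,(P_i(a)m_{\beta_1}-m_{\beta_1}Q''_i(a))\,n_{\alpha_1}\,m_{\beta_2}n_{\alpha_2}\cdots m_{\beta_r}n_{\alpha_r},\] \[Q''_k(a)=\mathfrak q_{1k}(a)-\sum\, n_{\alpha_r}m_{\beta_r}\cdots n_{\alpha_2}m_{\beta_2}\,n_{\alpha_1}(P_i(a)m_{\beta_1}-m_{\beta_1}Q''_i(a)),\] \[P''_k(b)=\mathfrak p_{2k}(b)-\sum\,(m_{\beta_1}Q_i(b)-P''_i(b)m_{\beta_1})\,n_{\alpha_1}\,m_{\beta_2}n_{\alpha_2}\cdots m_{\beta_r}n_{\alpha_r},\] \[Q_k(b)=\mathfrak q_{2k}(b)+\sum\, n_{\alpha_r}m_{\beta_r}\cdots n_{\alpha_2}m_{\beta_2}\,n_{\alpha_1}(m_{\beta_1}Q_i(b)-P''_i(b)m_{\beta_1}),\] each sum being over all $1\le r\le\lfloor k/2\rfloor$, $i\ge 0$ and $\alpha_1,\beta_1,\dots,\alpha_r,\beta_r\ge1$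 with $i+\sum_{\rho=1}^r(\alpha_\rho+\beta_\rho)=k$. Suppose that $\mathcal G$ is trivial. (1) Let $\mathcal L$ be a Lie higher derivation on $\mathcal G$. If $\mathcal L$ is proper, then $Q''_k(A)\subseteq\pi_B(Z(\mathcal G))$ and $P''_k(B)\subseteq\pi_A(Z(\mathcal G))$ for all $k\ge1$. Conversely, if $\mathcal G$ is weakly faithful and these inclusions hold for all $k\ge 1$, then $\mathcal L$ is proper. (2) If $\mathcal G$ is weakly faithful, $\pi_A(Z(\mathcal G))=Z(A)$ and $\pi_B(Z(\mathcal G))=Z(B)$, then $\mathcal G$ has the LHD property. -/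

import Mathlib

open MulOpposite

universe u uA uB uM uN

section General

/-- `{D_k}` (`k ≥ 0`) is a higher derivation on the `R`-algebra `S`. -/
def IsHigherDerivation {R : Type*} {S : Type*} [CommRing R] [Ring S] [Algebra R S]
    (D : ℕ → S →ₗ[R] S) : Prop :=
  D 0 = LinearMap.id ∧
    ∀ (k : ℕ) (x y : S),
      D k (x * y) = ∑ ij ∈ Finset.HasAntidiagonal.antidiagonal k, D ij.1 x * D ij.2 y

/-- `{L_k}` (`k ≥ 0`) is a Lie higher derivation on the `R`-algebra `S`; here `⁅x, y⁆ = x * y - y * x`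
is the commutator. -/
def IsLieHigherDerivation {R : Type*} {S : Type*} [CommRing R] [Ring S] [Algebra R S]
    (L : ℕ → S →ₗ[R] S) : Prop :=
  L 0 = LinearMap.id ∧
    ∀ (k : ℕ) (x y : S),
      L k ⁅x, y⁆ = ∑ ij ∈ Finset.HasAntidiagonal.antidiagonal k, ⁅L ij.1 x, L ij.2 y⁆

/-- `L = D + τ` with `D` a higher derivation and `τ = {τ_k}` (`k ≥ 1`) a sequence of center valued
linear maps vanishing at commutators. -/
def IsProperSeq {R : Type*} {S : Type*} [CommRing R] [Ring S] [Algebra R S]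
    (L : ℕ → S →ₗ[R] S) : Prop :=
  ∃ D τ : ℕ → S →ₗ[R] S,
    IsHigherDerivation D ∧
    (∀ k, 1 ≤ k → ∀ x : S, τ k x ∈ Subalgebra.center R S) ∧
    (∀ k, 1 ≤ k → ∀ x y : S, τ k ⁅x, y⁆ = 0) ∧
    L 0 = D 0 ∧ ∀ k, 1 ≤ k → L k = D k + τ k

/-- Every Lie higher derivation on the `R`-algebra `S` is proper. -/
def HasLHD (R : Type*) (S : Type*) [CommRing R] [Ring S] [Algebra R S] : Prop :=
  ∀ L : ℕ → S →ₗ[R] S, IsLieHigherDerivation L → IsProperSeq L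

/-- `2x = 0` implies `x = 0`. -/
def TwoTorsionFree (X : Type*) [AddCommGroup X] : Prop :=
  ∀ x : X, x + x = 0 → x = 0

end General

/-- A Morita context over `R` on unital `R`-algebras `A`, `B`, an `(A, B)`-bimodule `M` and a
`(B, A)`-bimodule `N`. Right actions are actions of the opposite ring, so `op b • m` is `mb`.
A bimodule map `M ⊗[B] N → A` is given as the corresponding `B`-balanced biadditive map
`Φ m n = mn` that is left and right `A`-linear, and similarly `Ψ n m = nm` for `N ⊗[A] M → B`.
The last two fields are the two commutative diagrams `(mn)m' = m(nm')`, `(nm)n' = n(mn')`. -/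
structure MoritaContext (R : Type u) (A : Type uA) (B : Type uB) (M : Type uM) (N : Type uN)
    [CommRing R] [Ring A] [Ring B] [Algebra R A] [Algebra R B]
    [AddCommGroup M] [AddCommGroup N] [Module R M] [Module R N]
    [Module A M] [Module Bᵐᵒᵖ M] [Module B N] [Module Aᵐᵒᵖ N] where
  Φ : M →ₗ[R] N →ₗ[R] A
  Ψ : N →ₗ[R] M →ₗ[R] B
  Φ_balanced : ∀ (m : M) (b : B) (n : N), Φ (op b • m) n = Φ m (b • n)
  Φ_left : ∀ (a : A) (m : M) (n : N), Φ (a • m) n = a * Φ m n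
  Φ_right : ∀ (m : M) (n : N) (a : A), Φ m (op a • n) = Φ m n * a
  Ψ_balanced : ∀ (n : N) (a : A) (m : M), Ψ (op a • n) m = Ψ n (a • m)
  Ψ_left : ∀ (b : B) (n : N) (m : M), Ψ (b • n) m = b * Ψ n m
  Ψ_right : ∀ (n : N) (m : M) (b : B), Ψ n (op b • m) = Ψ n m * b
  Φ_assoc : ∀ (m : M) (n : N) (m' : M), Φ m n • m' = op (Ψ n m') • m
  Ψ_assoc : ∀ (n : N) (m : M) (n' : N), Ψ n m • n' = op (Φ m n') • n

namespace MoritaContext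

section Defs

variable {R : Type u} {A : Type uA} {B : Type uB} {M : Type uM} {N : Type uN}
  [CommRing R] [Ring A] [Ring B] [Algebra R A] [Algebra R B]
  [AddCommGroup M] [AddCommGroup N] [Module R M] [Module R N]
  [Module A M] [Module Bᵐᵒᵖ M] [Module B N] [Module Aᵐᵒᵖ N]

/-- `MN = 0` and `NM = 0`. -/
def IsTrivial (C : MoritaContext R A B M N) : Prop :=
  (∀ (m : M) (n : N), C.Φ m n = 0) ∧ (∀ (n : N) (m : M), C.Ψ n m = 0)

/-- `aM = 0 = Na` implies `a = 0`, and `Mb = 0 = bN` implies `b = 0`. -/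
def WeaklyFaithful (_C : MoritaContext R A B M N) : Prop :=
  (∀ a : A, (∀ m : M, a • m = 0) → (∀ n : N, op a • n = 0) → a = 0) ∧
    (∀ b : B, (∀ m : M, op b • m = 0) → (∀ n : N, b • n = 0) → b = 0)

/-- The generalized matrix algebra of `C`: the matrices with rows `(a, m)` and `(n, b)`. -/
@[ext]
structure GMat (C : MoritaContext R A B M N) where
  a : A
  m : M
  n : N
  b : B

namespace GMat

variable {C : MoritaContext R A B M N}

instance : Zero C.GMat := ⟨⟨0, 0, 0, 0⟩⟩
instance : One C.GMat := ⟨⟨1, 0, 0, 1⟩⟩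
instance : Add C.GMat := ⟨fun x y => ⟨x.a + y.a, x.m + y.m, x.n + y.n, x.b + y.b⟩⟩
instance : Neg C.GMat := ⟨fun x => ⟨-x.a, -x.m, -x.n, -x.b⟩⟩
instance : Mul C.GMat :=
  ⟨fun x y => ⟨x.a * y.a + C.Φ x.m y.n, x.a • y.m + op y.b • x.m,
    op y.a • x.n + x.b • y.n, C.Ψ x.n y.m + x.b * y.b⟩⟩
instance : SMul R C.GMat := ⟨fun r x => ⟨r • x.a, r • x.m, r • x.n, r • x.b⟩⟩

@[simp] theorem zero_a : (0 : C.GMat).a = 0 := rfl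
@[simp] theorem zero_m : (0 : C.GMat).m = 0 := rfl
@[simp] theorem zero_n : (0 : C.GMat).n = 0 := rfl
@[simp] theorem zero_b : (0 : C.GMat).b = 0 := rfl
@[simp] theorem one_a : (1 : C.GMat).a = 1 := rfl
@[simp] theorem one_m : (1 : C.GMat).m = 0 := rfl
@[simp] theorem one_n : (1 : C.GMat).n = 0 := rfl
@[simp] theorem one_b : (1 : C.GMat).b = 1 := rfl
@[simp] theorem add_a (x y : C.GMat) : (x + y).a = x.a + y.a := rfl
@[simp] theorem add_m (x y : C.GMat) : (x + y).m = x.m + y.m := rfl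
@[simp] theorem add_n (x y : C.GMat) : (x + y).n = x.n + y.n := rfl
@[simp] theorem add_b (x y : C.GMat) : (x + y).b = x.b + y.b := rfl
@[simp] theorem neg_a (x : C.GMat) : (-x).a = -x.a := rfl
@[simp] theorem neg_m (x : C.GMat) : (-x).m = -x.m := rfl
@[simp] theorem neg_n (x : C.GMat) : (-x).n = -x.n := rfl
@[simp] theorem neg_b (x : C.GMat) : (-x).b = -x.b := rfl
@[simp] theorem mul_a (x y : C.GMat) : (x * y).a = x.a * y.a + C.Φ x.m y.n := rfl
@[simp] theorem mul_m (x y : C.GMat) : (x * y).m = x.a • y.m + op y.b • x.m := rfl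
@[simp] theorem mul_n (x y : C.GMat) : (x * y).n = op y.a • x.n + x.b • y.n := rfl
@[simp] theorem mul_b (x y : C.GMat) : (x * y).b = C.Ψ x.n y.m + x.b * y.b := rfl
@[simp] theorem smul_a (r : R) (x : C.GMat) : (r • x).a = r • x.a := rfl
@[simp] theorem smul_m (r : R) (x : C.GMat) : (r • x).m = r • x.m := rfl
@[simp] theorem smul_n (r : R) (x : C.GMat) : (r • x).n = r • x.n := rfl
@[simp] theorem smul_b (r : R) (x : C.GMat) : (r • x).b = r • x.b := rfl

instance : AddCommGroup C.GMat where
  add_assoc x y z := by ext <;> simp [add_assoc]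
  zero_add x := by ext <;> simp
  add_zero x := by ext <;> simp
  add_comm x y := by ext <;> simp [add_comm]
  neg_add_cancel x := by ext <;> simp
  nsmul := nsmulRec
  zsmul := zsmulRec

instance : Module R C.GMat where
  one_smul x := by ext <;> simp
  mul_smul r s x := by ext <;> simp [mul_smul]
  smul_zero r := by ext <;> simp
  smul_add r x y := by ext <;> simp
  add_smul r s x := by ext <;> simp [add_smul]
  zero_smul x := by ext <;> simp

instance [SMulCommClass A Bᵐᵒᵖ M] [SMulCommClass B Aᵐᵒᵖ N] : Ring C.GMat where
  __ := (inferInstance : AddCommGroup C.GMat)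
  zero_mul x := by ext <;> simp
  mul_zero x := by ext <;> simp
  one_mul x := by ext <;> simp
  mul_one x := by ext <;> simp
  left_distrib x y z := by ext <;> simp [mul_add, add_smul] <;> abel
  right_distrib x y z := by ext <;> simp [add_mul, add_smul] <;> abel
  mul_assoc x y z := by
    ext
    · simp only [mul_a, mul_m, mul_n, map_add, LinearMap.add_apply, C.Φ_left, C.Φ_right,
        C.Φ_balanced, add_mul, mul_add, mul_assoc]
      abel
    · simp only [mul_a, mul_m, mul_b, add_smul, smul_add, op_add, op_mul, mul_smul, C.Φ_assoc,
        smul_comm x.a (op z.b) y.m]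
      abel
    · simp only [mul_a, mul_n, mul_b, add_smul, smul_add, op_add, op_mul, mul_smul, C.Ψ_assoc,
        smul_comm x.b (op z.a) y.n]
      abel
    · simp only [mul_b, mul_m, mul_n, map_add, LinearMap.add_apply, C.Ψ_left, C.Ψ_right,
        C.Ψ_balanced, add_mul, mul_add, mul_assoc]
      abel

instance [SMulCommClass A Bᵐᵒᵖ M] [SMulCommClass B Aᵐᵒᵖ N]
    [IsScalarTower R A M] [IsScalarTower R Bᵐᵒᵖ M]
    [IsScalarTower R B N] [IsScalarTower R Aᵐᵒᵖ N] : Algebra R C.GMat :=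
  Algebra.ofModule
    (fun r x y => by
      have h1 : op y.b • r • x.m = r • op y.b • x.m := by
        rw [← algebraMap_smul Bᵐᵒᵖ r x.m, ← algebraMap_smul Bᵐᵒᵖ r (op y.b • x.m), smul_smul,
          smul_smul, Algebra.commutes]
      have h2 : op y.a • r • x.n = r • op y.a • x.n := by
        rw [← algebraMap_smul Aᵐᵒᵖ r x.n, ← algebraMap_smul Aᵐᵒᵖ r (op y.a • x.n), smul_smul,
          smul_smul, Algebra.commutes]
      ext <;> simp [smul_add, h1, h2])
    (fun r x y => by
      have h1 : x.a • r • y.m = r • x.a • y.m := by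
        rw [← algebraMap_smul A r y.m, ← algebraMap_smul A r (x.a • y.m), smul_smul, smul_smul,
          Algebra.commutes]
      have h2 : x.b • r • y.n = r • x.b • y.n := by
        rw [← algebraMap_smul B r y.n, ← algebraMap_smul B r (x.b • y.n), smul_smul, smul_smul,
          Algebra.commutes]
      ext <;> simp [op_smul, smul_add, h1, h2])

end GMat

variable (C : MoritaContext R A B M N)

/-- The natural projection `π_A`. -/
def prA : C.GMat →ₗ[R] A where
  toFun x := x.a
  map_add' _ _ := rfl
  map_smul' _ _ := rfl

/-- The `M`-entry of a matrix. -/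
def prM : C.GMat →ₗ[R] M where
  toFun x := x.m
  map_add' _ _ := rfl
  map_smul' _ _ := rfl

/-- The `N`-entry of a matrix. -/
def prN : C.GMat →ₗ[R] N where
  toFun x := x.n
  map_add' _ _ := rfl
  map_smul' _ _ := rfl

/-- The natural projection `π_B`. -/
def prB : C.GMat →ₗ[R] B where
  toFun x := x.b
  map_add' _ _ := rfl
  map_smul' _ _ := rfl

/-- `a ↦ a ⊕ 0`. -/
def inA : A →ₗ[R] C.GMat where
  toFun a := ⟨a, 0, 0, 0⟩
  map_add' _ _ := by ext <;> simp
  map_smul' _ _ := by ext <;> simp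

/-- `b ↦ 0 ⊕ b`. -/
def inB : B →ₗ[R] C.GMat where
  toFun b := ⟨0, 0, 0, b⟩
  map_add' _ _ := by ext <;> simp
  map_smul' _ _ := by ext <;> simp

/-- Index set of the inner sums for given `k` and `r = s + 1`: the triples `(i, α, β)` with
`i + ∑ ρ, (α ρ + β ρ) = k` and all `α ρ, β ρ` in `{1, …, k}` (so that `i ≤ k - 2`). -/
def idx (k s : ℕ) : Finset (Fin k × (Fin (s + 1) → ℕ) × (Fin (s + 1) → ℕ)) :=
  (Finset.univ ×ˢ (Fintype.piFinset fun _ => Finset.Icc 1 k) ×ˢ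
    (Fintype.piFinset fun _ => Finset.Icc 1 k)).filter
      fun t => (t.1 : ℕ) + ∑ ρ, (t.2.1 ρ + t.2.2 ρ) = k

variable (L : ℕ → C.GMat →ₗ[R] C.GMat)

/-- `m_k = 𝔣_{1k}(1)`, the `M`-entry of `L_k (1 ⊕ 0)`. -/
def mSeq (k : ℕ) : M := C.prM (L k (C.inA 1))

/-- `n_k = 𝔤_{1k}(1)`, the `N`-entry of `L_k (1 ⊕ 0)`. -/
def nSeq (k : ℕ) : N := C.prN (L k (C.inA 1))

/-- `m_{β_2} n_{α_2} ⋯ m_{β_r} n_{α_r}`, where `r = s + 1`. -/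
def mnWord {s : ℕ} (α β : Fin (s + 1) → ℕ) : A :=
  (List.ofFn fun ρ : Fin s => C.Φ (C.mSeq L (β ρ.succ)) (C.nSeq L (α ρ.succ))).prod

/-- `n_{α_r} m_{β_r} ⋯ n_{α_2} m_{β_2}`, where `r = s + 1`. -/
def nmWord {s : ℕ} (α β : Fin (s + 1) → ℕ) : B :=
  (List.ofFn fun ρ : Fin s => C.Ψ (C.nSeq L (α ρ.succ)) (C.mSeq L (β ρ.succ))).reverse.prod

/-- The pair `(P_k(a), Q''_k(a))`: it is `(a, 0)` for `k = 0`, and for `k ≥ 1`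
`P_k = 𝔭_{1k} + p_k`, `Q''_k = 𝔮_{1k} - q''_k`, where, summing over `1 ≤ r ≤ ⌊k/2⌋` and
`i + (α + β)_r = k`,
`p_k(a) = ∑ (P_i(a) m_{β_1} - m_{β_1} Q''_i(a)) n_{α_1} (m_{β_2} n_{α_2} ⋯ m_{β_r} n_{α_r})`,
`q''_k(a) = ∑ (n_{α_r} m_{β_r} ⋯ n_{α_2} m_{β_2}) n_{α_1} (P_i(a) m_{β_1} - m_{β_1} Q''_i(a))`. -/
def pairA : ℕ → A → A × B
  | 0, a => (a, 0)
  | k + 1, a =>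
    (C.prA (L (k + 1) (C.inA a)) +
        ∑ s ∈ Finset.range ((k + 1) / 2), ∑ t ∈ idx (k + 1) s,
          C.Φ ((pairA t.1 a).1 • C.mSeq L (t.2.2 0) - op (pairA t.1 a).2 • C.mSeq L (t.2.2 0))
              (C.nSeq L (t.2.1 0)) * C.mnWord L t.2.1 t.2.2,
      C.prB (L (k + 1) (C.inA a)) -
        ∑ s ∈ Finset.range ((k + 1) / 2), ∑ t ∈ idx (k + 1) s,
          C.nmWord L t.2.1 t.2.2 * C.Ψ (C.nSeq L (t.2.1 0))
              ((pairA t.1 a).1 • C.mSeq L (t.2.2 0) - op (pairA t.1 a).2 • C.mSeq L (t.2.2 0)))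
termination_by k => k
decreasing_by all_goals exact t.1.isLt

/-- The pair `(P''_k(b), Q_k(b))`: it is `(0, b)` for `k = 0`, and for `k ≥ 1`
`P''_k = 𝔭_{2k} - p''_k`, `Q_k = 𝔮_{2k} + q_k`, where, with the same ranges of summation,
`p''_k(b) = ∑ (m_{β_1} Q_i(b) - P''_i(b) m_{β_1}) n_{α_1} (m_{β_2} n_{α_2} ⋯ m_{β_r} n_{α_r})`,
`q_k(b) = ∑ (n_{α_r} m_{β_r} ⋯ n_{α_2} m_{β_2}) n_{α_1} (m_{β_1} Q_i(b) - P''_i(b) m_{β_1})`. -/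
def pairB : ℕ → B → A × B
  | 0, b => (0, b)
  | k + 1, b =>
    (C.prA (L (k + 1) (C.inB b)) -
        ∑ s ∈ Finset.range ((k + 1) / 2), ∑ t ∈ idx (k + 1) s,
          C.Φ (op (pairB t.1 b).2 • C.mSeq L (t.2.2 0) - (pairB t.1 b).1 • C.mSeq L (t.2.2 0))
              (C.nSeq L (t.2.1 0)) * C.mnWord L t.2.1 t.2.2,
      C.prB (L (k + 1) (C.inB b)) +
        ∑ s ∈ Finset.range ((k + 1) / 2), ∑ t ∈ idx (k + 1) s,
          C.nmWord L t.2.1 t.2.2 * C.Ψ (C.nSeq L (t.2.1 0))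
              (op (pairB t.1 b).2 • C.mSeq L (t.2.2 0) - (pairB t.1 b).1 • C.mSeq L (t.2.2 0)))
termination_by k => k
decreasing_by all_goals exact t.1.isLt

/-- The map `Q''_k : A → B` attached to the sequence `L`. -/
def Qpp (k : ℕ) (a : A) : B := (C.pairA L k a).2

/-- The map `P''_k : B → A` attached to the sequence `L`. -/
def Ppp (k : ℕ) (b : B) : A := (C.pairB L k b).1

end Defs

end MoritaContext

/-! Triviality does two things. Every summand of the recursions contains a factor `mn` or `nm`, so
for `k ≥ 1` the maps `Qpp` and `Ppp` are just the opposite diagonal entries of `L_k` on `A ⊕ 0` and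
`0 ⊕ B`. Also, both diagonal entries become multiplicative. Hence a higher derivation has zero
opposite entries, since `1 ⊕ 0` and `0 ⊕ 1` are idempotent, and in a proper `L` these entries come
from the central part `τ` alone.

Conversely, weak faithfulness makes a central matrix determined by either diagonal entry, so the
opposite entries of `L` lift uniquely, hence linearly, to a central `τ`. Then `D = L - τ` is a Lie
higher derivation with zero opposite entries, and the core is that such a `D` is multiplicative
(`IsLieHigherDerivation.isHigherDerivation`). Write `D(x) = ∑ D_k(x) t^k`, a Lie homomorphism into
power series. A diagonal matrix times a corner is governed by a bracket one of whose two products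
vanishes. For diagonal `d`, `d'` the defect `D(dd') - D(d)D(d')` annihilates `D(M)` and `D(N)` from
both sides, and weak faithfulness kills its coefficients one after another.

Part (2) reduces to this: `A ⊕ 0` commutes with `0 ⊕ B`, which forces the opposite entries to be
central in `B` and `A`. -/

theorem LinearMap.exists_lift_of_injective {R P Q Z : Type*} [CommRing R] [AddCommGroup P]
    [AddCommGroup Q] [AddCommGroup Z] [Module R P] [Module R Q] [Module R Z]
    (g : Z →ₗ[R] Q) (hg : Function.Injective g) (f : P →ₗ[R] Q) (h : ∀ x, ∃ z, g z = f x) :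
    ∃ σ : P →ₗ[R] Z, ∀ x, g (σ x) = f x := by
  choose s hs using h
  -- Preimages under an injective map are unique, so any choice of them is linear.
  refine ⟨⟨⟨s, fun x y => hg ?_⟩, fun r x => hg ?_⟩, hs⟩
  · simp [hs]
  · simp [hs]

/-! ### Generating series of Lie higher derivations -/

section LieSeries

variable {R : Type*} {S : Type*} [CommRing R] [Ring S] [Algebra R S]

/-- The generating series `x ↦ ∑ D_k(x) t^k` of a sequence of linear maps. -/
noncomputable def genSeries (D : ℕ → S →ₗ[R] S) : S →+ PowerSeries S where
  toFun x := PowerSeries.mk fun k => D k x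
  map_zero' := by ext; simp
  map_add' x y := by ext; simp

@[simp] theorem coeff_genSeries (D : ℕ → S →ₗ[R] S) (k : ℕ) (x : S) :
    PowerSeries.coeff k (genSeries D x) = D k x := by
  simp [genSeries]

/-- The convolution identity is the Cauchy product, read off coefficient by coefficient. -/
theorem IsLieHigherDerivation.genSeries_sub {D : ℕ → S →ₗ[R] S} (hD : IsLieHigherDerivation D)
    (x y : S) :
    genSeries D (x * y - y * x) =
      genSeries D x * genSeries D y - genSeries D y * genSeries D x := by
  ext k
  rw [coeff_genSeries, ← Ring.lie_def, hD.2, map_sub, PowerSeries.coeff_mul,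
    PowerSeries.coeff_mul, ← Finset.Nat.sum_antidiagonal_swap
      (f := fun p => PowerSeries.coeff p.1 (genSeries D y) * _), ← Finset.sum_sub_distrib]
  simp [Ring.lie_def]

theorem isHigherDerivation_of_genSeries_mul {D : ℕ → S →ₗ[R] S} (h0 : D 0 = LinearMap.id)
    (h : ∀ x y, genSeries D (x * y) = genSeries D x * genSeries D y) :
    IsHigherDerivation D := by
  refine ⟨h0, fun k x y => ?_⟩
  have := congrArg (PowerSeries.coeff k) (h x y)
  simpa [PowerSeries.coeff_mul] using this

/-- The series of `x` has constant term `x`, so only that term meets the lowest possible coefficient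
of `X`. -/
theorem coeff_mul_genSeries_of_lt {D : ℕ → S →ₗ[R] S} (h0 : D 0 = LinearMap.id)
    {X : PowerSeries S} {k : ℕ} (hX : ∀ i < k, PowerSeries.coeff i X = 0) (x : S) :
    PowerSeries.coeff k (X * genSeries D x) = PowerSeries.coeff k X * x := by
  rw [PowerSeries.coeff_mul, Finset.sum_eq_single (k, 0)]
  · simp [h0]
  · rintro ⟨i, j⟩ hij hne
    rw [Finset.HasAntidiagonal.mem_antidiagonal] at hij
    have : i < k := by
      rcases Nat.eq_zero_or_pos j with rfl | hj
      · exact absurd (by simpa using hij) (by simpa using hne)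
      · simp at hij; omega
    simp [hX i this]
  · simp

theorem coeff_genSeries_mul_of_lt {D : ℕ → S →ₗ[R] S} (h0 : D 0 = LinearMap.id)
    {X : PowerSeries S} {k : ℕ} (hX : ∀ i < k, PowerSeries.coeff i X = 0) (x : S) :
    PowerSeries.coeff k (genSeries D x * X) = x * PowerSeries.coeff k X := by
  rw [PowerSeries.coeff_mul, Finset.sum_eq_single (0, k)]
  · simp [h0]
  · rintro ⟨i, j⟩ hij hne
    rw [Finset.HasAntidiagonal.mem_antidiagonal] at hij
    have : j < k := by
      rcases Nat.eq_zero_or_pos i with rfl | hi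
      · exact absurd (by simpa using hij) (by simpa using hne)
      · simp at hij; omega
    simp [hX j this]
  · simp

theorem IsLieHigherDerivation.sub_central {L τ : ℕ → S →ₗ[R] S} (hL : IsLieHigherDerivation L)
    (h0 : τ 0 = 0) (hZ : ∀ k x, τ k x ∈ Subalgebra.center R S)
    (hτ : ∀ k (x y : S), τ k ⁅x, y⁆ = 0) : IsLieHigherDerivation fun k => L k - τ k := by
  refine ⟨by simp [h0, hL.1], fun k x y => ?_⟩
  have hl (k) (x z : S) : τ k x * z = z * τ k x :=
    (Subalgebra.mem_center_iff.1 (hZ k x) z).symm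
  rw [LinearMap.sub_apply, hτ, sub_zero, hL.2]
  refine Finset.sum_congr rfl fun ij _ => ?_
  simp only [Ring.lie_def, LinearMap.sub_apply, sub_mul, mul_sub]
  -- Central factors commute past everything, so all cross terms cancel in pairs.
  rw [hl ij.1 x (L ij.2 y), hl ij.1 x (τ ij.2 y), hl ij.2 y (L ij.1 x)]
  abel

end LieSeries

namespace MoritaContext

variable {R : Type u} {A : Type uA} {B : Type uB} {M : Type uM} {N : Type uN}
  [CommRing R] [Ring A] [Ring B] [Algebra R A] [Algebra R B]
  [AddCommGroup M] [AddCommGroup N] [Module R M] [Module R N]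
  [Module A M] [Module Bᵐᵒᵖ M] [Module B N] [Module Aᵐᵒᵖ N]
  {C : MoritaContext R A B M N}

/-! ### Entries, corners and the effect of triviality -/

namespace GMat

/-- The matrix with `M`-entry `m` and all other entries zero. -/
def inM (m : M) : C.GMat := ⟨0, m, 0, 0⟩

/-- The matrix with `N`-entry `n` and all other entries zero. -/
def inN (n : N) : C.GMat := ⟨0, 0, n, 0⟩

@[simp] theorem sub_a (x y : C.GMat) : (x - y).a = x.a - y.a := by simp [sub_eq_add_neg]
@[simp] theorem sub_m (x y : C.GMat) : (x - y).m = x.m - y.m := by simp [sub_eq_add_neg]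
@[simp] theorem sub_n (x y : C.GMat) : (x - y).n = x.n - y.n := by simp [sub_eq_add_neg]
@[simp] theorem sub_b (x y : C.GMat) : (x - y).b = x.b - y.b := by simp [sub_eq_add_neg]

@[simp] theorem inA_a (a : A) : (C.inA a).a = a := rfl
@[simp] theorem inA_m (a : A) : (C.inA a).m = 0 := rfl
@[simp] theorem inA_n (a : A) : (C.inA a).n = 0 := rfl
@[simp] theorem inA_b (a : A) : (C.inA a).b = 0 := rfl
@[simp] theorem inB_a (b : B) : (C.inB b).a = 0 := rfl
@[simp] theorem inB_m (b : B) : (C.inB b).m = 0 := rfl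
@[simp] theorem inB_n (b : B) : (C.inB b).n = 0 := rfl
@[simp] theorem inB_b (b : B) : (C.inB b).b = b := rfl
@[simp] theorem inM_a (m : M) : (inM m : C.GMat).a = 0 := rfl
@[simp] theorem inM_m (m : M) : (inM m : C.GMat).m = m := rfl
@[simp] theorem inM_n (m : M) : (inM m : C.GMat).n = 0 := rfl
@[simp] theorem inM_b (m : M) : (inM m : C.GMat).b = 0 := rfl
@[simp] theorem inN_a (n : N) : (inN n : C.GMat).a = 0 := rfl
@[simp] theorem inN_m (n : N) : (inN n : C.GMat).m = 0 := rfl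
@[simp] theorem inN_n (n : N) : (inN n : C.GMat).n = n := rfl
@[simp] theorem inN_b (n : N) : (inN n : C.GMat).b = 0 := rfl

@[simp] theorem prA_apply (x : C.GMat) : C.prA x = x.a := rfl
@[simp] theorem prB_apply (x : C.GMat) : C.prB x = x.b := rfl

theorem sum_a {ι : Type*} (s : Finset ι) (f : ι → C.GMat) : (∑ i ∈ s, f i).a = ∑ i ∈ s, (f i).a :=
  map_sum C.prA f s

theorem sum_b {ι : Type*} (s : Finset ι) (f : ι → C.GMat) : (∑ i ∈ s, f i).b = ∑ i ∈ s, (f i).b :=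
  map_sum C.prB f s

theorem eq_diag_add (x : C.GMat) : x = C.inA x.a + C.inB x.b + inM x.m + inN x.n := by
  ext <;> simp

end GMat

open GMat

theorem Qpp_eq (htriv : C.IsTrivial) (L : ℕ → C.GMat →ₗ[R] C.GMat) {k : ℕ} (hk : 1 ≤ k) (a : A) :
    C.Qpp L k a = (L k (C.inA a)).b := by
  obtain ⟨k, rfl⟩ := Nat.exists_eq_succ_of_ne_zero (Nat.one_le_iff_ne_zero.1 hk)
  rw [Qpp, pairA]
  simp only [htriv.2, mul_zero, Finset.sum_const_zero, sub_zero, prB_apply]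

theorem Ppp_eq (htriv : C.IsTrivial) (L : ℕ → C.GMat →ₗ[R] C.GMat) {k : ℕ} (hk : 1 ≤ k) (b : B) :
    C.Ppp L k b = (L k (C.inB b)).a := by
  obtain ⟨k, rfl⟩ := Nat.exists_eq_succ_of_ne_zero (Nat.one_le_iff_ne_zero.1 hk)
  rw [Ppp, pairB]
  simp only [htriv.1, zero_mul, Finset.sum_const_zero, sub_zero, prA_apply]

variable [SMulCommClass A Bᵐᵒᵖ M] [SMulCommClass B Aᵐᵒᵖ N]

@[simp] theorem lie_a (htriv : C.IsTrivial) (x y : C.GMat) : (⁅x, y⁆ : C.GMat).a = ⁅x.a, y.a⁆ := by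
  simp [Ring.lie_def, htriv.1]

@[simp] theorem lie_b (htriv : C.IsTrivial) (x y : C.GMat) : (⁅x, y⁆ : C.GMat).b = ⁅x.b, y.b⁆ := by
  simp [Ring.lie_def, htriv.2]

variable [IsScalarTower R A M] [IsScalarTower R Bᵐᵒᵖ M]
  [IsScalarTower R B N] [IsScalarTower R Aᵐᵒᵖ N]

/-! ### The center of the generalized matrix algebra -/

theorem center_a_comm {z : C.GMat} (hz : z ∈ Subalgebra.center R C.GMat) (a : A) :
    a * z.a = z.a * a := by
  simpa using congrArg GMat.a (Subalgebra.mem_center_iff.1 hz (C.inA a))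

theorem center_b_comm {z : C.GMat} (hz : z ∈ Subalgebra.center R C.GMat) (b : B) :
    b * z.b = z.b * b := by
  simpa using congrArg GMat.b (Subalgebra.mem_center_iff.1 hz (C.inB b))

theorem center_m_eq_zero {z : C.GMat} (hz : z ∈ Subalgebra.center R C.GMat) : z.m = 0 := by
  simpa using congrArg GMat.m (Subalgebra.mem_center_iff.1 hz (C.inA 1))

theorem center_n_eq_zero {z : C.GMat} (hz : z ∈ Subalgebra.center R C.GMat) : z.n = 0 := by
  simpa using (congrArg GMat.n (Subalgebra.mem_center_iff.1 hz (C.inA 1))).symm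

theorem center_smul_m {z : C.GMat} (hz : z ∈ Subalgebra.center R C.GMat) (m : M) :
    z.a • m = op z.b • m := by
  simpa using (congrArg GMat.m (Subalgebra.mem_center_iff.1 hz (inM m))).symm

theorem center_smul_n {z : C.GMat} (hz : z ∈ Subalgebra.center R C.GMat) (n : N) :
    op z.a • n = z.b • n := by
  simpa using congrArg GMat.n (Subalgebra.mem_center_iff.1 hz (inN n))

/-- A central matrix is diagonal and its two entries act identically on `M` and on `N`; if one entry
is zero, the other acts as zero and weak faithfulness applies. -/
theorem center_eq_zero_of_b (hf : C.WeaklyFaithful) {z : C.GMat}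
    (hz : z ∈ Subalgebra.center R C.GMat) (hb : z.b = 0) : z = 0 := by
  have ha : z.a = 0 := hf.1 _ (fun m => by simp [center_smul_m hz, hb])
    (fun n => by simp [center_smul_n hz, hb])
  ext <;> simp [ha, hb, center_m_eq_zero hz, center_n_eq_zero hz]

theorem center_eq_zero_of_a (hf : C.WeaklyFaithful) {z : C.GMat}
    (hz : z ∈ Subalgebra.center R C.GMat) (ha : z.a = 0) : z = 0 := by
  have hb : z.b = 0 := hf.2 _ (fun m => by simp [← center_smul_m hz, ha])
    (fun n => by simp [← center_smul_n hz, ha])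
  ext <;> simp [ha, hb, center_m_eq_zero hz, center_n_eq_zero hz]

/-! ### Higher derivations have zero opposite entries -/

section HigherDerivation

/-- Apply `D` to `a = a · 1` inside `A ⊕ 0`: since the `B`-entry is multiplicative, everything
reduces to `a = 1`, where idempotency allows an induction on `k`. -/
theorem IsHigherDerivation.inA_b_eq_zero (htriv : C.IsTrivial) {D : ℕ → C.GMat →ₗ[R] C.GMat}
    (hD : IsHigherDerivation D) (k : ℕ) (a : A) : (D k (C.inA a)).b = 0 := by
  have hmul (k : ℕ) (a : A) : (D k (C.inA a)).b =
      ∑ ij ∈ Finset.HasAntidiagonal.antidiagonal k,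
        (D ij.1 (C.inA a)).b * (D ij.2 (C.inA 1)).b := by
    have h := hD.2 k (C.inA a) (C.inA 1)
    have h1 : C.inA a * C.inA 1 = C.inA a := by ext <;> simp
    rw [h1] at h
    simp [h, sum_b, htriv.2]
  have hone (k : ℕ) : (D k (C.inA 1)).b = 0 := by
    induction k using Nat.strong_induction_on with
    | _ k ih =>
      rw [hmul]
      refine Finset.sum_eq_zero fun ij hij => ?_
      rw [Finset.HasAntidiagonal.mem_antidiagonal] at hij
      rcases Nat.eq_zero_or_pos ij.2 with h | h
      · simp [h, hD.1]
      · rw [ih ij.1 (by omega), zero_mul]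
  rw [hmul]
  exact Finset.sum_eq_zero fun ij _ => by rw [hone, mul_zero]

theorem IsHigherDerivation.inB_a_eq_zero (htriv : C.IsTrivial) {D : ℕ → C.GMat →ₗ[R] C.GMat}
    (hD : IsHigherDerivation D) (k : ℕ) (b : B) : (D k (C.inB b)).a = 0 := by
  have hmul (k : ℕ) (b : B) : (D k (C.inB b)).a =
      ∑ ij ∈ Finset.HasAntidiagonal.antidiagonal k,
        (D ij.1 (C.inB b)).a * (D ij.2 (C.inB 1)).a := by
    have h := hD.2 k (C.inB b) (C.inB 1)
    have h1 : C.inB b * C.inB 1 = C.inB b := by ext <;> simp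
    rw [h1] at h
    simp [h, sum_a, htriv.1]
  have hone (k : ℕ) : (D k (C.inB 1)).a = 0 := by
    induction k using Nat.strong_induction_on with
    | _ k ih =>
      rw [hmul]
      refine Finset.sum_eq_zero fun ij hij => ?_
      rw [Finset.HasAntidiagonal.mem_antidiagonal] at hij
      rcases Nat.eq_zero_or_pos ij.2 with h | h
      · simp [h, hD.1]
      · rw [ih ij.1 (by omega), zero_mul]
  rw [hmul]
  exact Finset.sum_eq_zero fun ij _ => by rw [hone, mul_zero]

end HigherDerivation

/-! ### From Lie higher derivations to higher derivations -/

section LieHigherDerivation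

variable {D : ℕ → C.GMat →ₗ[R] C.GMat}

/-- Lie higher derivations preserve the `M`-corner of a trivial generalized matrix algebra. -/
theorem IsLieHigherDerivation.apply_inM (hN : TwoTorsionFree N) (htriv : C.IsTrivial)
    (hD : IsLieHigherDerivation D) (m : M) (k : ℕ) :
    ∃ m', D k (inM m) = inM m' := by
  induction k using Nat.strong_induction_on with
  | _ k ih =>
    have h := hD.2 k (C.inA 1) (inM m)
    have h1 : ⁅C.inA 1, (inM m : C.GMat)⁆ = inM m := by
      ext <;> simp [Ring.lie_def]
    -- The isolated term is `[1 ⊕ 0, D_k(m)]`; the others involve `D_j(m)` with `j < k` and lie in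
    -- the `M`-corner by induction.
    rw [h1, ← Finset.add_sum_erase _ _ (a := (0, k)) (by simp)] at h
    have hs : ∃ m', ∑ ij ∈ (Finset.HasAntidiagonal.antidiagonal k).erase (0, k),
        ⁅D ij.1 (C.inA 1), D ij.2 (inM m)⁆ = (inM m' : C.GMat) := by
      refine Finset.sum_induction _ (fun x : C.GMat => ∃ m', x = inM m') ?_ ⟨0, rfl⟩ ?_
      · rintro _ _ ⟨x, rfl⟩ ⟨y, rfl⟩
        exact ⟨x + y, by ext <;> simp⟩
      · rintro ⟨i, j⟩ hij
        rw [Finset.mem_erase, Finset.HasAntidiagonal.mem_antidiagonal] at hij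
        obtain ⟨m', hm'⟩ := ih j (by
          rcases Nat.eq_zero_or_pos i with rfl | hi
          · exact absurd hij (by simp)
          · simp at hij; omega)
        refine ⟨(D i (C.inA 1)).a • m' - op (D i (C.inA 1)).b • m', ?_⟩
        simp only [hm']
        ext <;> simp [Ring.lie_def, htriv.1, htriv.2]
    obtain ⟨m', hm'⟩ := hs
    rw [hm', hD.1] at h
    have ha := congrArg GMat.a h
    have hn := congrArg GMat.n h
    have hb := congrArg GMat.b h
    simp [Ring.lie_def, htriv.1, htriv.2] at ha hn hb
    refine ⟨(D k (inM m)).m, ?_⟩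
    ext
    · simpa using ha
    · simp
    -- Bracketing with `1 ⊕ 0` negates the `N`-entry, so this entry equals its own negative.
    · exact hN _ (by nth_rewrite 1 [hn]; simp)
    · simpa using hb

/-- Lie higher derivations preserve the `N`-corner of a trivial generalized matrix algebra. -/
theorem IsLieHigherDerivation.apply_inN (hM : TwoTorsionFree M) (htriv : C.IsTrivial)
    (hD : IsLieHigherDerivation D) (n : N) (k : ℕ) :
    ∃ n', D k (inN n) = inN n' := by
  induction k using Nat.strong_induction_on with
  | _ k ih =>
    have h := hD.2 k (C.inB 1) (inN n)
    have h1 : ⁅C.inB 1, (inN n : C.GMat)⁆ = inN n := by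
      ext <;> simp [Ring.lie_def]
    rw [h1, ← Finset.add_sum_erase _ _ (a := (0, k)) (by simp)] at h
    have hs : ∃ n', ∑ ij ∈ (Finset.HasAntidiagonal.antidiagonal k).erase (0, k),
        ⁅D ij.1 (C.inB 1), D ij.2 (inN n)⁆ = (inN n' : C.GMat) := by
      refine Finset.sum_induction _ (fun x : C.GMat => ∃ n', x = inN n') ?_ ⟨0, rfl⟩ ?_
      · rintro _ _ ⟨x, rfl⟩ ⟨y, rfl⟩
        exact ⟨x + y, by ext <;> simp⟩
      · rintro ⟨i, j⟩ hij
        rw [Finset.mem_erase, Finset.HasAntidiagonal.mem_antidiagonal] at hij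
        obtain ⟨n', hn'⟩ := ih j (by
          rcases Nat.eq_zero_or_pos i with rfl | hi
          · exact absurd hij (by simp)
          · simp at hij; omega)
        refine ⟨(D i (C.inB 1)).b • n' - op (D i (C.inB 1)).a • n', ?_⟩
        simp only [hn']
        ext <;> simp [Ring.lie_def, htriv.1, htriv.2]
    obtain ⟨n', hn'⟩ := hs
    rw [hn', hD.1] at h
    have ha := congrArg GMat.a h
    have hm := congrArg GMat.m h
    have hb := congrArg GMat.b h
    simp [Ring.lie_def, htriv.1, htriv.2] at ha hm hb
    refine ⟨(D k (inN n)).n, ?_⟩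
    ext
    · simpa using ha
    · exact hM _ (by nth_rewrite 1 [hm]; simp)
    · simp
    · simpa using hb

/-- A power series is zero if it commutes with `D(1 ⊕ 0)` and annihilates `D(M)`, `D(N)` from both
sides. -/
theorem powerSeries_eq_zero_of_annihilates (hf : C.WeaklyFaithful) (h0 : D 0 = LinearMap.id)
    {X : PowerSeries C.GMat}
    (he : genSeries D (C.inA 1) * X = X * genSeries D (C.inA 1))
    (hXM : ∀ m, X * genSeries D (inM m) = 0) (hMX : ∀ m, genSeries D (inM m) * X = 0)
    (hXN : ∀ n, X * genSeries D (inN n) = 0) (hNX : ∀ n, genSeries D (inN n) * X = 0) :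
    X = 0 := by
  ext1 k
  induction k using Nat.strong_induction_on with
  | _ k ih =>
    simp only [map_zero] at ih ⊢
    have l (x : C.GMat) := coeff_mul_genSeries_of_lt h0 ih x
    have r (x : C.GMat) := coeff_genSeries_mul_of_lt h0 ih x
    have ce := (r (C.inA 1)).symm.trans ((congrArg _ he).trans (l (C.inA 1)))
    have cm (m : M) := (l (inM m)).symm.trans (by rw [hXM, map_zero])
    have mc (m : M) := (r (inM m)).symm.trans (by rw [hMX, map_zero])
    have cn (n : N) := (l (inN n)).symm.trans (by rw [hXN, map_zero])
    have nc (n : N) := (r (inN n)).symm.trans (by rw [hNX, map_zero])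
    ext
    -- The coefficient is diagonal because it commutes with `1 ⊕ 0`. Multiplying by `M` on the right
    -- and by `N` on the left isolates its `A`-entry; the opposite sides isolate the `B`-entry.
    · refine hf.1 _ (fun m => ?_) (fun n => ?_)
      · simpa using congrArg GMat.m (cm m)
      · simpa using congrArg GMat.n (nc n)
    · simpa using congrArg GMat.m ce
    · simpa using (congrArg GMat.n ce).symm
    · refine hf.2 _ (fun m => ?_) (fun n => ?_)
      · simpa using congrArg GMat.m (mc m)
      · simpa using congrArg GMat.n (cn n)

/-- On a weakly faithful trivial generalized matrix algebra, a Lie higher derivation that maps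
`A ⊕ 0` and `0 ⊕ B` to matrices with vanishing opposite diagonal entry is a higher derivation. -/
theorem IsLieHigherDerivation.isHigherDerivation (hM : TwoTorsionFree M) (hN : TwoTorsionFree N)
    (htriv : C.IsTrivial) (hf : C.WeaklyFaithful) (hD : IsLieHigherDerivation D)
    (hA : ∀ k a, (D k (C.inA a)).b = 0) (hB : ∀ k b, (D k (C.inB b)).a = 0) :
    IsHigherDerivation D := by
  have eM (m : M) (k : ℕ) := IsLieHigherDerivation.apply_inM hN htriv hD m k
  have eN (n : N) (k : ℕ) := IsLieHigherDerivation.apply_inN hM htriv hD n k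
  have prod_zero {x y : C.GMat} (h : ∀ i j, D i x * D j y = 0) :
      genSeries D x * genSeries D y = 0 := by
    ext1 k
    simp [PowerSeries.coeff_mul, h]
  -- These four products vanish in each degree: the diagonal entry that would act on the corner is
  -- zero by `hA` or `hB`, and triviality removes the rest.
  have hMA (m a) : genSeries D (inM m) * genSeries D (C.inA a) = 0 := prod_zero fun i j => by
    obtain ⟨m', h⟩ := eM m i
    ext <;> simp [h, hA, htriv.1]
  have hBM (b m) : genSeries D (C.inB b) * genSeries D (inM m) = 0 := prod_zero fun i j => by
    obtain ⟨m', h⟩ := eM m j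
    ext <;> simp [h, hB, htriv.1, htriv.2]
  have hAN (a n) : genSeries D (C.inA a) * genSeries D (inN n) = 0 := prod_zero fun i j => by
    obtain ⟨n', h⟩ := eN n j
    ext <;> simp [h, hA, htriv.1, htriv.2]
  have hNB (n b) : genSeries D (inN n) * genSeries D (C.inB b) = 0 := prod_zero fun i j => by
    obtain ⟨n', h⟩ := eN n i
    ext <;> simp [h, hB, htriv.2]
  have hMM (m m') : genSeries D (inM m) * genSeries D (inM m') = 0 := prod_zero fun i j => by
    obtain ⟨_, h⟩ := eM m i
    obtain ⟨_, h'⟩ := eM m' j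
    ext <;> simp [h, h']
  have hNN (n n') : genSeries D (inN n) * genSeries D (inN n') = 0 := prod_zero fun i j => by
    obtain ⟨_, h⟩ := eN n i
    obtain ⟨_, h'⟩ := eN n' j
    ext <;> simp [h, h']
  have hMN (m n) : genSeries D (inM m) * genSeries D (inN n) = 0 := prod_zero fun i j => by
    obtain ⟨_, h⟩ := eM m i
    obtain ⟨_, h'⟩ := eN n j
    ext <;> simp [h, h', htriv.1]
  have hNM (n m) : genSeries D (inN n) * genSeries D (inM m) = 0 := prod_zero fun i j => by
    obtain ⟨_, h⟩ := eN n i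
    obtain ⟨_, h'⟩ := eM m j
    ext <;> simp [h, h', htriv.2]
  have hlie := hD.genSeries_sub
  -- Since `D(m)D(a) = 0`, the bracket identity for `[a, m] = am` is already a product identity;
  -- `D(b)D(m) = 0` lets `b` be added freely. The next three are analogous.
  have dM (a b m) : genSeries D (C.inA a + C.inB b) * genSeries D (inM m) =
      genSeries D (inM (a • m)) := by
    have h := hlie (C.inA a) (inM m)
    rw [hMA, sub_zero, show C.inA a * inM m - inM m * C.inA a = inM (a • m) by ext <;> simp] at h
    rw [h, map_add, add_mul, hBM, add_zero]
  have Md (m a b) : genSeries D (inM m) * genSeries D (C.inA a + C.inB b) =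
      genSeries D (inM (op b • m)) := by
    have h := hlie (inM m) (C.inB b)
    rw [hBM, sub_zero, show inM m * C.inB b - C.inB b * inM m = inM (op b • m) by
      ext <;> simp] at h
    rw [h, map_add, mul_add, hMA, zero_add]
  have dN (a b n) : genSeries D (C.inA a + C.inB b) * genSeries D (inN n) =
      genSeries D (inN (b • n)) := by
    have h := hlie (C.inB b) (inN n)
    rw [hNB, sub_zero, show C.inB b * inN n - inN n * C.inB b = inN (b • n) by ext <;> simp] at h
    rw [h, map_add, add_mul, hAN, zero_add]
  have Nd (n a b) : genSeries D (inN n) * genSeries D (C.inA a + C.inB b) =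
      genSeries D (inN (op a • n)) := by
    have h := hlie (inN n) (C.inA a)
    rw [hAN, sub_zero, show inN n * C.inA a - C.inA a * inN n = inN (op a • n) by
      ext <;> simp] at h
    rw [h, map_add, mul_add, hNB, add_zero]
  have ed (a b) : genSeries D (C.inA 1) * genSeries D (C.inA a + C.inB b) =
      genSeries D (C.inA a + C.inB b) * genSeries D (C.inA 1) := by
    have h := hlie (C.inA 1) (C.inA a + C.inB b)
    rw [show C.inA 1 * (C.inA a + C.inB b) - (C.inA a + C.inB b) * C.inA 1 = 0 by ext <;> simp,
      map_zero] at h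
    exact (sub_eq_zero.1 h.symm)
  have dd (a b a' b') : genSeries D (C.inA a + C.inB b) * genSeries D (C.inA a' + C.inB b') =
      genSeries D (C.inA (a * a') + C.inB (b * b')) := by
    -- The defect is annihilated because `D(d)` acts on the images of the corners as `d` does on the
    -- corners, and there `(dd')m = d(d'm)`.
    refine (sub_eq_zero.1 (powerSeries_eq_zero_of_annihilates hf hD.1 ?_ (fun m => ?_)
      (fun m => ?_) (fun n => ?_) (fun n => ?_))).symm
    · rw [mul_sub, sub_mul, ed, mul_assoc _ _ (genSeries D (C.inA 1)), ← ed a', ← mul_assoc, ed,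
        mul_assoc]
    · rw [sub_mul, mul_assoc, dM, dM, dM, mul_smul, sub_self]
    · rw [mul_sub, ← mul_assoc, Md, Md, Md, op_mul, mul_smul, sub_self]
    · rw [sub_mul, mul_assoc, dN, dN, dN, mul_smul, sub_self]
    · rw [mul_sub, ← mul_assoc, Nd, Nd, Nd, op_mul, mul_smul, sub_self]
  refine isHigherDerivation_of_genSeries_mul hD.1 fun x y => ?_
  have hxy : x * y = (C.inA (x.a * y.a) + C.inB (x.b * y.b)) + inM (x.a • y.m) +
      inM (op y.b • x.m) + inN (op y.a • x.n) + inN (x.b • y.n) := by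
    ext <;> simp [htriv.1, htriv.2]
  rw [hxy]
  conv_rhs => rw [eq_diag_add x, eq_diag_add y]
  -- Only the corners are split off; each diagonal part stays a single argument so that `dd`, `dM`
  -- and their analogues apply.
  rw [map_add _ _ (inN y.n), map_add _ _ (inM y.m), map_add _ _ (inN x.n), map_add _ _ (inM x.m)]
  simp only [add_mul, mul_add _ _ (genSeries D (inM _)), mul_add _ _ (genSeries D (inN _)),
    dd, dM, dN, Md, Nd, hMM, hMN, hNM, hNN]
  simp only [map_add]
  abel

end LieHigherDerivation

/-! ### The criterion for properness -/

section Proper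

variable {L : ℕ → C.GMat →ₗ[R] C.GMat}

theorem IsProperSeq.range_subset (htriv : C.IsTrivial) (hL : IsProperSeq L) {k : ℕ} (hk : 1 ≤ k) :
    Set.range (C.Qpp L k) ⊆ C.prB '' (Subalgebra.center R C.GMat : Set C.GMat) ∧
      Set.range (C.Ppp L k) ⊆ C.prA '' (Subalgebra.center R C.GMat : Set C.GMat) := by
  obtain ⟨D, τ, hD, hZ, -, -, hLk⟩ := hL
  constructor
  · rintro _ ⟨a, rfl⟩
    refine ⟨τ k (C.inA a), hZ k hk _, ?_⟩
    simp [Qpp_eq htriv L hk, hLk k hk, IsHigherDerivation.inA_b_eq_zero htriv hD]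
  · rintro _ ⟨b, rfl⟩
    refine ⟨τ k (C.inB b), hZ k hk _, ?_⟩
    simp [Ppp_eq htriv L hk, hLk k hk, IsHigherDerivation.inB_a_eq_zero htriv hD]

theorem exists_central_lift_b (hf : C.WeaklyFaithful) (f : A →ₗ[R] B)
    (h : ∀ a, ∃ z ∈ Subalgebra.center R C.GMat, z.b = f a) :
    ∃ σ : A →ₗ[R] C.GMat, ∀ a, σ a ∈ Subalgebra.center R C.GMat ∧ (σ a).b = f a := by
  let Z := Subalgebra.toSubmodule (Subalgebra.center R C.GMat)
  obtain ⟨σ, hσ⟩ := LinearMap.exists_lift_of_injective (C.prB ∘ₗ Z.subtype)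
    ((injective_iff_map_eq_zero _).2 fun z hz => Subtype.ext (center_eq_zero_of_b hf z.2 hz)) f
    (fun a => by obtain ⟨z, hz, hb⟩ := h a; exact ⟨⟨z, hz⟩, hb⟩)
  exact ⟨Z.subtype ∘ₗ σ, fun a => ⟨(σ a).2, hσ a⟩⟩

theorem exists_central_lift_a (hf : C.WeaklyFaithful) (f : B →ₗ[R] A)
    (h : ∀ b, ∃ z ∈ Subalgebra.center R C.GMat, z.a = f b) :
    ∃ σ : B →ₗ[R] C.GMat, ∀ b, σ b ∈ Subalgebra.center R C.GMat ∧ (σ b).a = f b := by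
  let Z := Subalgebra.toSubmodule (Subalgebra.center R C.GMat)
  obtain ⟨σ, hσ⟩ := LinearMap.exists_lift_of_injective (C.prA ∘ₗ Z.subtype)
    ((injective_iff_map_eq_zero _).2 fun z hz => Subtype.ext (center_eq_zero_of_a hf z.2 hz)) f
    (fun b => by obtain ⟨z, hz, ha⟩ := h b; exact ⟨⟨z, hz⟩, ha⟩)
  exact ⟨Z.subtype ∘ₗ σ, fun b => ⟨(σ b).2, hσ b⟩⟩

/-- The central part is `τ_k(x) = σ_k(x.a) + ρ_k(x.b)`, with `σ_k` and `ρ_k` the central lifts of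
the opposite entries. -/
theorem IsLieHigherDerivation.isProperSeq (hM : TwoTorsionFree M) (hN : TwoTorsionFree N)
    (htriv : C.IsTrivial) (hf : C.WeaklyFaithful) (hL : IsLieHigherDerivation L)
    (hA : ∀ k a, ∃ z ∈ Subalgebra.center R C.GMat, z.b = (L k (C.inA a)).b)
    (hB : ∀ k b, ∃ z ∈ Subalgebra.center R C.GMat, z.a = (L k (C.inB b)).a) :
    IsProperSeq L := by
  choose σ hσ using fun k => exists_central_lift_b hf (C.prB ∘ₗ L k ∘ₗ C.inA) (hA k)
  choose ρ hρ using fun k => exists_central_lift_a hf (C.prA ∘ₗ L k ∘ₗ C.inB) (hB k)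
  have hZ (k) (x : C.GMat) : (σ k ∘ₗ C.prA + ρ k ∘ₗ C.prB) x ∈ Subalgebra.center R C.GMat :=
    add_mem (hσ k _).1 (hρ k _).1
  -- `L_0 = id` has zero opposite entries, so the lifts vanish in degree `0`.
  have h0 : σ 0 ∘ₗ C.prA + ρ 0 ∘ₗ C.prB = 0 := by
    ext1 x
    have h1 := center_eq_zero_of_b hf (hσ 0 x.a).1 (by simp [(hσ 0 _).2, hL.1])
    have h2 := center_eq_zero_of_a hf (hρ 0 x.b).1 (by simp [(hρ 0 _).2, hL.1])
    simp [h1, h2]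
  have hσlie (k) (a a' : A) : σ k ⁅a, a'⁆ = 0 := by
    refine center_eq_zero_of_b hf (hσ k _).1 ?_
    have h : C.inA ⁅a, a'⁆ = ⁅C.inA a, C.inA a'⁆ := by
      ext <;> simp [Ring.lie_def]
    rw [(hσ k _).2, LinearMap.comp_apply, LinearMap.comp_apply, h, hL.2, prB_apply, sum_b]
    refine Finset.sum_eq_zero fun ij _ => ?_
    -- Each bracket in the sum has a left factor that is the `B`-entry of a central matrix, hence
    -- central in `B`.
    obtain ⟨z, hz, hzb⟩ := hA ij.1 a
    rw [lie_b htriv, ← hzb, Ring.lie_def, center_b_comm hz, sub_self]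
  have hρlie (k) (b b' : B) : ρ k ⁅b, b'⁆ = 0 := by
    refine center_eq_zero_of_a hf (hρ k _).1 ?_
    have h : C.inB ⁅b, b'⁆ = ⁅C.inB b, C.inB b'⁆ := by
      ext <;> simp [Ring.lie_def]
    rw [(hρ k _).2, LinearMap.comp_apply, LinearMap.comp_apply, h, hL.2, prA_apply, sum_a]
    refine Finset.sum_eq_zero fun ij _ => ?_
    obtain ⟨z, hz, hza⟩ := hB ij.1 b
    rw [lie_a htriv, ← hza, Ring.lie_def, center_a_comm hz, sub_self]
  have hlie (k) (x y : C.GMat) : (σ k ∘ₗ C.prA + ρ k ∘ₗ C.prB) ⁅x, y⁆ = 0 := by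
    simp [lie_a htriv, lie_b htriv, hσlie, hρlie]
  have hD := hL.sub_central (τ := fun k => σ k ∘ₗ C.prA + ρ k ∘ₗ C.prB) h0 hZ hlie
  refine ⟨_, fun k => σ k ∘ₗ C.prA + ρ k ∘ₗ C.prB,
    IsLieHigherDerivation.isHigherDerivation hM hN htriv hf hD (fun k a => ?_) (fun k b => ?_),
    fun k _ => hZ k, fun k _ => hlie k, ?_, fun k _ => ?_⟩
  · simp [(hσ k a).2]
  · simp [(hρ k b).2]
  · simp [h0]
  · simp

/-- Expand `L_k` of `[a ⊕ 0, 0 ⊕ b] = 0` in the `B`-entry. By induction the terms with `i < k`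
vanish, leaving the bracket of the entry with `b`. -/
theorem IsLieHigherDerivation.inA_b_mem_center (htriv : C.IsTrivial)
    (hL : IsLieHigherDerivation L) (k : ℕ) (a : A) :
    (L k (C.inA a)).b ∈ Subalgebra.center R B := by
  induction k using Nat.strong_induction_on with
  | _ k ih =>
    rw [Subalgebra.mem_center_iff]
    intro b
    have h := congrArg GMat.b (hL.2 k (C.inA a) (C.inB b))
    rw [show ⁅C.inA a, C.inB b⁆ = 0 by ext <;> simp [Ring.lie_def], map_zero, sum_b,
      Finset.sum_eq_single (k, 0)] at h
    · simp [hL.1, Ring.lie_def] at h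
      exact (sub_eq_zero.1 h.symm).symm
    · rintro ⟨i, j⟩ hij hne
      rw [Finset.HasAntidiagonal.mem_antidiagonal] at hij
      have hi : i < k := by
        rcases Nat.eq_zero_or_pos j with rfl | hj
        · exact absurd (by simpa using hij) (by simpa using hne)
        · simp at hij; omega
      rw [lie_b htriv, Ring.lie_def, Subalgebra.mem_center_iff.1 (ih i hi), sub_self]
    · simp

theorem IsLieHigherDerivation.inB_a_mem_center (htriv : C.IsTrivial)
    (hL : IsLieHigherDerivation L) (k : ℕ) (b : B) :
    (L k (C.inB b)).a ∈ Subalgebra.center R A := by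
  induction k using Nat.strong_induction_on with
  | _ k ih =>
    rw [Subalgebra.mem_center_iff]
    intro a
    have h := congrArg GMat.a (hL.2 k (C.inB b) (C.inA a))
    rw [show ⁅C.inB b, C.inA a⁆ = 0 by ext <;> simp [Ring.lie_def], map_zero, sum_a,
      Finset.sum_eq_single (k, 0)] at h
    · simp [hL.1, Ring.lie_def] at h
      exact (sub_eq_zero.1 h.symm).symm
    · rintro ⟨i, j⟩ hij hne
      rw [Finset.HasAntidiagonal.mem_antidiagonal] at hij
      have hi : i < k := by
        rcases Nat.eq_zero_or_pos j with rfl | hj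
        · exact absurd (by simpa using hij) (by simpa using hne)
        · simp at hij; omega
      rw [lie_a htriv, Ring.lie_def, Subalgebra.mem_center_iff.1 (ih i hi), sub_self]
    · simp

end Proper

end MoritaContext

theorem mainTheorem12
    {R : Type u} {A : Type uA} {B : Type uB} {M : Type uM} {N : Type uN}
    [CommRing R] [Ring A] [Ring B] [Algebra R A] [Algebra R B]
    [AddCommGroup M] [AddCommGroup N] [Module R M] [Module R N]
    [Module A M] [Module Bᵐᵒᵖ M] [SMulCommClass A Bᵐᵒᵖ M]
    [IsScalarTower R A M] [IsScalarTower R Bᵐᵒᵖ M]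
    [Module B N] [Module Aᵐᵒᵖ N] [SMulCommClass B Aᵐᵒᵖ N]
    [IsScalarTower R B N] [IsScalarTower R Aᵐᵒᵖ N]
    (C : MoritaContext R A B M N)
    (hM : TwoTorsionFree M) (hN : TwoTorsionFree N)
    (htriv : C.IsTrivial) :
    (∀ L : ℕ → C.GMat →ₗ[R] C.GMat, IsLieHigherDerivation L →
      (IsProperSeq L → ∀ k, 1 ≤ k →
        Set.range (C.Qpp L k) ⊆ C.prB '' (Subalgebra.center R C.GMat : Set C.GMat) ∧
        Set.range (C.Ppp L k) ⊆ C.prA '' (Subalgebra.center R C.GMat : Set C.GMat)) ∧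
      (C.WeaklyFaithful →
        (∀ k, 1 ≤ k →
          Set.range (C.Qpp L k) ⊆ C.prB '' (Subalgebra.center R C.GMat : Set C.GMat) ∧
          Set.range (C.Ppp L k) ⊆ C.prA '' (Subalgebra.center R C.GMat : Set C.GMat)) →
        IsProperSeq L)) ∧
    (C.WeaklyFaithful →
      C.prA '' (Subalgebra.center R C.GMat : Set C.GMat) = (Subalgebra.center R A : Set A) →
      C.prB '' (Subalgebra.center R C.GMat : Set C.GMat) = (Subalgebra.center R B : Set B) →
      HasLHD R C.GMat) := by
  refine ⟨fun L hL => ⟨fun hP k hk => MoritaContext.IsProperSeq.range_subset htriv hP hk,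
    fun hf h => ?_⟩, fun hf hA hB L hL => ?_⟩
  · refine MoritaContext.IsLieHigherDerivation.isProperSeq hM hN htriv hf hL (fun k a => ?_)
      (fun k b => ?_)
    -- The inclusions are assumed only for `k ≥ 1`; in degree `0` the entry is zero.
    · rcases Nat.eq_zero_or_pos k with rfl | hk
      · exact ⟨0, zero_mem _, by simp [hL.1]⟩
      · rw [← MoritaContext.Qpp_eq htriv L hk]
        exact (h k hk).1 ⟨a, rfl⟩
    · rcases Nat.eq_zero_or_pos k with rfl | hk
      · exact ⟨0, zero_mem _, by simp [hL.1]⟩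
      · rw [← MoritaContext.Ppp_eq htriv L hk]
        exact (h k hk).2 ⟨b, rfl⟩
  · refine MoritaContext.IsLieHigherDerivation.isProperSeq hM hN htriv hf hL (fun k a => ?_)
      (fun k b => ?_)
    · exact hB.ge (MoritaContext.IsLieHigherDerivation.inA_b_mem_center htriv hL k a)
    · exact hA.ge (MoritaContext.IsLieHigherDerivation.inB_a_mem_center htriv hL k b)
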